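/- **Setting.** Let $d\ge 0$ be an integer and let $\|\cdot\|$ be the Euclidean norm on $\mathbb{R}^d$. Let $F\colon\mathbb{R}^d\to\mathbb{R}^d$ be $L$-Lipschitz, let $G\colon\mathbb{R}^d\rightrightarrows\mathbb{R}^d$ be maximally monotone, and let $\rho>0$ be such that $F+G$ is maximally $\rho$-cohypomonotone, i.e. $\langle u-v,x-y\rangle\ge-\rho\|u-v\|^2$ for all $u\in(F+G)(x)$, $v\in(F+G)(y)$, and the graph of $F+G$ is not strictly contained in the graph of another operator with this property. Let $\rho<\eta$ and $\eta L<1$, let $x^\star$ be a solution of $0\in F(x^\star)+G(x^\star)$, and let $x_0\in\mathbb{R}^d$. For a set-valued operator $A$ write $J_A=(\mathrm{Id}+A)^{-1}$. **Algorithm.** Let $\alpha=1-\rho/\eta$, $\beta_k=\frac1{k+2}$ and $N_k=\left\lceil\frac{4(1+\eta L)}{1-\eta L}\log\big(98\sqrt{k+2}\,\log(k+2)\big)\right\rceil$. The inexact Halpern iteration is $$x_{k+1}=\beta_kx_0+(1-\beta_k)\big((1-\alpha)x_k+\alpha\,\widetilde J(x_k)\big),\qquad k=0,1,2,\dots,$$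 where $\widetilde J(x_k)=z_{N_k}$ is the result of $N_k$ steps of the forward-backward-forward method $$z_0=x_k,\qquad z_{t+1/2}=J_{\tau\eta G}(z_t-\tau B(z_t)),\qquad z_{t+1}=z_{t+1/2}+\tau B(z_t)-\tau B(z_{t+1/2}),$$ with $B(z)=z+\eta F(z)-x_k$ and $\tau=\frac1{2(1+\eta L)}$. One first-order oracle call consists of one evaluation of $F$ and one evaluation of a resolvent of $G$. **Claim.** For every $\varepsilon>0$, let $K=\left\lceil\frac{4\|x_0-x^\star\|}{(\eta-\rho)\varepsilon}\right\rceil$. Then $J_{\eta(F+G)}(x_K)$ is a single point and $$\eta^{-1}\big\|(\mathrm{Id}-J_{\eta(F+G)})(x_K)\big\|\le\varepsilon .$$ Moreover, the total number of first-order oracle calls made to compute $x_K$ is $$\widetilde O\left(\frac{(1+\eta L)\,\|x_0-x^\star\|}{\varepsilon\,(\eta-\rho)\,(1-\eta L)}\right),$$ in the following sense: there are absolute constants $C>0$ and $p\in\mathbb{N}$, independent of $d,F,G,L,\rho,\eta,x_0,x^\star,\varepsilon$, such that with $X=\frac{\|x_0-x^\star\|}{\varepsilon(\eta-\rho)}$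 the number of calls is at most $$C\,\frac{1+\eta L}{1-\eta L}\,\max\{1,X\}\,\big(\log(2+X)\big)^p .$$ -/

import Mathlib

open scoped NNReal

noncomputable section

namespace InexactHalpern

/-- The space `ℝ^d` with the Euclidean norm. -/
abbrev E (d : ℕ) : Type := EuclideanSpace ℝ (Fin d)

/-- A set-valued operator `A : ℝ^d ⇉ ℝ^d`; its graph is `{(x, u) | u ∈ A x}`. -/
abbrev SetOp (d : ℕ) : Type := E d → Set (E d)

variable {d : ℕ}

/-- The operator `F + G` for a single-valued `F` and a set-valued `G`. -/
def addOp (F : E d → E d) (G : SetOp d) : SetOp d :=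
  fun x => {w | ∃ u ∈ G x, w = F x + u}

/-- The operator `c A`. -/
def smulOp (c : ℝ) (A : SetOp d) : SetOp d :=
  fun x => {w | ∃ u ∈ A x, w = c • u}

/-- `A` is monotone. -/
def IsMonotoneOp (A : SetOp d) : Prop :=
  ∀ x y u v : E d, u ∈ A x → v ∈ A y → 0 ≤ inner ℝ (u - v) (x - y)

/-- `A` is maximally monotone: no monotone operator has a strictly larger graph. -/
def IsMaximallyMonotone (A : SetOp d) : Prop :=
  IsMonotoneOp A ∧ ∀ A' : SetOp d, IsMonotoneOp A' → (∀ x, A x ⊆ A' x) → A' = A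

/-- `A` is `ρ`-cohypomonotone. -/
def IsCohypomonotone (ρ : ℝ) (A : SetOp d) : Prop :=
  ∀ x y u v : E d, u ∈ A x → v ∈ A y → -ρ * ‖u - v‖ ^ 2 ≤ inner ℝ (u - v) (x - y)

/-- `A` is maximally `ρ`-cohypomonotone: no `ρ`-cohypomonotone operator has a strictly larger
graph. -/
def IsMaximallyCohypomonotone (ρ : ℝ) (A : SetOp d) : Prop :=
  IsCohypomonotone ρ A ∧
    ∀ A' : SetOp d, IsCohypomonotone ρ A' → (∀ x, A x ⊆ A' x) → A' = A

/-- The resolvent `J_A = (Id + A)⁻¹`, as a set-valued operator. -/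
def setResolvent (A : SetOp d) : SetOp d :=
  fun x => {y | ∃ u ∈ A y, x = y + u}

open Classical in
/-- A value of the resolvent `J_A` at `x` (the value, where `J_A` is single-valued; the arbitrary
point `0` where `J_A x` is empty). -/
def resolventMap (A : SetOp d) (x : E d) : E d :=
  if h : (setResolvent A x).Nonempty then h.some else 0

/-- The result of a computation with oracle access to `F` and to the resolvents of `G`, together
with the number of evaluations of `F` and of resolvents of `G` that it made. -/
structure Counted (α : Type) where
  /-- the computed value -/
  val : α
  /-- the number of evaluations of `F` -/
  evals : ℕ
  /-- the number of evaluations of resolvents of `G` -/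
  resolvents : ℕ

/-- Computations are composed by running one after the other; the counts add up, and operations
other than oracle queries are free. -/
instance : Monad Counted where
  pure a := ⟨a, 0, 0⟩
  bind c f := ⟨(f c.val).val, c.evals + (f c.val).evals, c.resolvents + (f c.val).resolvents⟩

/-- One call to the first-order oracle provides one evaluation of `F` and one resolvent of `G`;
this is the number of calls that a computation needs. -/
def Counted.oracleCalls {α : Type} (c : Counted α) : ℕ := max c.evals c.resolvents

/-- Query: evaluate `F` at `x`. -/
def queryF (F : E d → E d) (x : E d) : Counted (E d) := ⟨F x, 1, 0⟩

/-- Query: evaluate the resolvent `J_{cG}` at `x`. -/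
def queryResolvent (G : SetOp d) (c : ℝ) (x : E d) : Counted (E d) :=
  ⟨resolventMap (smulOp c G) x, 0, 1⟩

/-- The forward-backward-forward method `FBF(z₀, N, A, B_in, L_B)`, with step size
`τ = 1 / (2 L_B)` and `B = B_in - z₀`. The operator `A` is accessed through
`JA τ = J_{τ A}`, and the last argument is the number `N` of iterations. -/
def fbf (z₀ : E d) (JA : ℝ → E d → Counted (E d)) (Bin : E d → Counted (E d)) (LB : ℝ) :
    ℕ → Counted (E d)
  | 0 => pure z₀
  | t + 1 => do
    let τ : ℝ := 1 / (2 * LB)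
    let z ← fbf z₀ JA Bin LB t
    let b ← Bin z
    let w ← JA τ (z - τ • (b - z₀))
    let b' ← Bin w
    return w + τ • (b - z₀) - τ • (b' - z₀)

/-- The number `N_k` of inner iterations at outer iteration `k`. -/
def innerIterations (η L : ℝ) (k : ℕ) : ℕ :=
  ⌈4 * (1 + η * L) / (1 - η * L) *
    Real.log (98 * Real.sqrt ((k : ℝ) + 2) * Real.log ((k : ℝ) + 2))⌉₊

/-- The approximation `FBF(x, N, η G, Id + η F, 1 + η L)` of `J_{η(F+G)}(x)`. The resolvent
`J_{τ (η G)}` is the resolvent `J_{(τ η) G}` of `G`, and each evaluation of `Id + η F` evaluates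
`F` once. -/
def approxResolvent (F : E d → E d) (G : SetOp d) (η L : ℝ) (x : E d) (N : ℕ) :
    Counted (E d) :=
  fbf x (fun τ y => queryResolvent G (τ * η) y)
    (fun z => do
      let f ← queryF F z
      return z + η • f)
    (1 + η * L) N

/-- The inexact Halpern iteration: the computation of the iterate `x_k` from `x₀`, with
`β_k = 1 / (k + 2)` and `α = 1 - ρ / η`. -/
def halpern (F : E d → E d) (G : SetOp d) (η L ρ : ℝ) (x₀ : E d) : ℕ → Counted (E d)
  | 0 => pure x₀
  | k + 1 => do
    let α : ℝ := 1 - ρ / η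
    let β : ℝ := 1 / ((k : ℝ) + 2)
    let x ← halpern F G η L ρ x₀ k
    let J ← approxResolvent F G η L x (innerIterations η L k)
    return β • x₀ + (1 - β) • ((1 - α) • x + α • J)

end InexactHalpern

end

open InexactHalpern

/-
Minty's theorem, obtained here from Sion's minimax theorem, makes the resolvents of `G` everywhere
defined, and the Banach fixed point theorem extends this to `J = J_{η(F + G)}`, since `η F` is a
contraction. Cohypomonotonicity of `F + G` says that the displacement `α (Id - J)` of the relaxed
map `(1 - α) Id + α J` is firmly nonexpansive. Computing `J (x)` amounts to finding the zero of
`η G + B`, where `B` is strongly monotone and Lipschitz, so each step of the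
forward-backward-forward method contracts the distance to `J (x)` by a fixed factor.

The Halpern iteration with exact values of `J` has the nonincreasing potential
`k (k + 1) / 2 * ‖p k‖ ^ 2 + (k + 1) * ⟪p k, x k - x 0⟫` in its displacements `p k`, which bounds
`‖p k‖` by a multiple of `1 / (k + 2)`. Inexact values raise the potential at step `k` by
`O (1 / ((k + 2) * log (k + 2) ^ 2))`, provided that the bound on `‖p k‖` still holds; these
increments are summable, so potential and bound persist together by induction.
-/

namespace InexactHalpern

section InnerProductSpace

variable {V : Type*} [NormedAddCommGroup V] [InnerProductSpace ℝ V]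

theorem inner_sub_sub_eq_dist_midpoint_sq (a b y : V) :
    inner ℝ (a - y) (b - y) = dist y (midpoint ℝ a b) ^ 2 - (dist a b / 2) ^ 2 := by
  obtain ⟨u, rfl⟩ : ∃ u, a = y + u := ⟨a - y, by abel⟩
  obtain ⟨v, rfl⟩ : ∃ v, b = y + v := ⟨b - y, by abel⟩
  have hmid : y - midpoint ℝ (y + u) (y + v) = -(1 / 2 : ℝ) • (u + v) := by
    rw [midpoint_eq_smul_add, invOf_eq_inv]
    module
  rw [dist_eq_norm, dist_eq_norm, hmid, norm_smul, mul_pow, norm_add_sq_real,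
    add_sub_add_left_eq_sub, div_pow, norm_sub_sq_real, add_sub_cancel_left, add_sub_cancel_left]
  norm_num
  ring

theorem convexOn_inner_sub_sub (a b : V) :
    ConvexOn ℝ Set.univ fun y => inner ℝ (a - y) (b - y) := by
  simp only [inner_sub_sub_eq_dist_midpoint_sq]
  exact ((convexOn_univ_dist _).pow (fun _ _ => dist_nonneg) 2).sub (concaveOn_const _ convex_univ)

theorem inner_sub_sub_nonpos_iff {a b y : V} :
    inner ℝ (a - y) (b - y) ≤ 0 ↔ y ∈ Metric.closedBall (midpoint ℝ a b) (dist a b / 2) := by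
  rw [inner_sub_sub_eq_dist_midpoint_sq, sub_nonpos, Metric.mem_closedBall,
    sq_le_sq₀ dist_nonneg (by positivity)]

-- Weighting the antitonicity inequalities by `w i * w j` gives twice the left-hand side.
theorem sum_mul_inner_sub_centroid_nonpos {ι : Type*} [Fintype ι] {a b : ι → V} {w : ι → ℝ}
    (hab : ∀ i j, inner ℝ (a i - a j) (b i - b j) ≤ 0) (hw : w ∈ stdSimplex ℝ ι) :
    ∑ i, w i * inner ℝ (a i - ∑ j, w j • a j) (b i - ∑ j, w j • a j) ≤ 0 := by
  set m := ∑ j, w j • a j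
  have hcenter : ∑ i, w i • (a i - m) = 0 := by
    simp only [smul_sub, Finset.sum_sub_distrib, ← Finset.sum_smul, hw.2, one_smul, m, sub_self]
  have hexpand (i : ι) : a i - m = ∑ j, w j • (a i - a j) := by
    simp only [smul_sub, Finset.sum_sub_distrib, ← Finset.sum_smul, hw.2, one_smul, m]
  have hdrop : ∑ i, w i * inner ℝ (a i - m) (b i - m) =
      ∑ i, ∑ j, w i * w j * inner ℝ (a i - a j) (b i) := by
    have hzero : ∑ i, w i * inner ℝ (a i - m) m = 0 := by
      simp only [← real_inner_smul_left, ← sum_inner, hcenter, inner_zero_left]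
    simp only [inner_sub_right (_ - m), mul_sub, Finset.sum_sub_distrib, hzero, sub_zero]
    refine Finset.sum_congr rfl fun i _ => ?_
    rw [hexpand i, sum_inner, Finset.mul_sum]
    simp only [real_inner_smul_left, mul_assoc]
  have hswap : ∑ i, ∑ j, w i * w j * inner ℝ (a i - a j) (b i) =
      -∑ i, ∑ j, w i * w j * inner ℝ (a i - a j) (b j) := by
    rw [Finset.sum_comm]
    simp only [← Finset.sum_neg_distrib]
    refine Finset.sum_congr rfl fun i _ => Finset.sum_congr rfl fun j _ => ?_
    rw [← neg_sub (a i), inner_neg_left]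
    ring
  have hdouble : ∑ i, ∑ j, w i * w j * inner ℝ (a i - a j) (b i - b j) ≤ 0 :=
    Finset.sum_nonpos fun i _ => Finset.sum_nonpos fun j _ =>
      mul_nonpos_of_nonneg_of_nonpos (mul_nonneg (hw.1 i) (hw.1 j)) (hab i j)
  simp only [inner_sub_right, mul_sub, Finset.sum_sub_distrib] at hdouble
  linarith

-- By Sion's minimax theorem it is enough to treat each convex combination of the functions
-- `y ↦ ⟪a i - y, b i - y⟫`, and the centroid of the points `a i` makes such a combination
-- nonpositive.
theorem exists_forall_inner_sub_sub_nonpos_of_finite {ι : Type*} [Finite ι] {a b : ι → V}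
    (hab : ∀ i j, inner ℝ (a i - a j) (b i - b j) ≤ 0) :
    ∃ y, ∀ i, inner ℝ (a i - y) (b i - y) ≤ 0 := by
  classical
  have := Fintype.ofFinite ι
  rcases isEmpty_or_nonempty ι with hι | ⟨⟨i₀⟩⟩
  · exact ⟨0, isEmptyElim⟩
  let S : Set V := convexHull ℝ (Set.range a)
  have hS : Convex ℝ S := convex_convexHull ℝ _
  have haS (i : ι) : a i ∈ S := subset_convexHull ℝ _ ⟨i, rfl⟩
  let f : V → (ι → ℝ) → ℝ := fun y w => ∑ i, w i * inner ℝ (a i - y) (b i - y)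
  have hconvex : ∀ w ∈ stdSimplex ℝ ι, ConvexOn ℝ S (f · w) := fun w hw => by
    simpa only [Finset.sum_fn] using Finset.sum_induction
      (fun i y => w i * inner ℝ (a i - y) (b i - y)) (ConvexOn ℝ S) (fun _ _ => ConvexOn.add)
      (convexOn_const 0 hS)
      fun i _ => ((convexOn_inner_sub_sub (a i) (b i)).smul (hw.1 i)).subset S.subset_univ hS
  have hconcave (y : V) : ConcaveOn ℝ (stdSimplex ℝ ι) (f y) :=
    ((∑ i, inner ℝ (a i - y) (b i - y) • LinearMap.proj i : (ι → ℝ) →ₗ[ℝ] ℝ).concaveOn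
      (convex_stdSimplex ℝ ι)).congr fun w _ => by simp [f, mul_comm]
  obtain ⟨y, -, w, hw, hsaddle⟩ := Sion.exists_isSaddlePointOn (f := f)
    ⟨a i₀, haS i₀⟩ hS ((Set.finite_range a).isCompact_convexHull ℝ)
    (fun w _ => (by fun_prop : Continuous (f · w)).lowerSemicontinuous.lowerSemicontinuousOn _)
    (fun w hw => (hconvex w hw).quasiconvexOn)
    (convex_stdSimplex ℝ ι) ⟨_, single_mem_stdSimplex ℝ i₀⟩ (isCompact_stdSimplex ℝ ι)
    (fun y _ => (by fun_prop : Continuous (f y)).upperSemicontinuous.upperSemicontinuousOn _)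
    (fun y _ => (hconcave y).quasiconcaveOn)
  refine ⟨y, fun i => ?_⟩
  calc inner ℝ (a i - y) (b i - y) = f y (Pi.single i 1) := by simp [f, Pi.single_apply]
    _ ≤ f (∑ j, w j • a j) w :=
      hsaddle _ (hS.sum_mem (fun i _ => hw.1 i) hw.2 fun i _ => haS i) _
        (single_mem_stdSimplex ℝ i)
    _ ≤ 0 := sum_mul_inner_sub_centroid_nonpos hab hw

theorem exists_forall_inner_sub_sub_nonpos [ProperSpace V] {ι : Type*} {a b : ι → V}
    (hab : ∀ i j, inner ℝ (a i - a j) (b i - b j) ≤ 0) :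
    ∃ y, ∀ i, inner ℝ (a i - y) (b i - y) ≤ 0 := by
  classical
  rcases isEmpty_or_nonempty ι with hι | ⟨⟨i₀⟩⟩
  · exact ⟨0, isEmptyElim⟩
  let B : ι → Set V := fun i => Metric.closedBall (midpoint ℝ (a i) (b i)) (dist (a i) (b i) / 2)
  have hfinite (t : Finset ι) : (B i₀ ∩ ⋂ i ∈ t, B i).Nonempty := by
    obtain ⟨y, hy⟩ := exists_forall_inner_sub_sub_nonpos_of_finite
      (ι := ↥(insert i₀ t)) fun i j => hab i j
    exact ⟨y, inner_sub_sub_nonpos_iff.1 (hy ⟨i₀, by simp⟩), Set.mem_iInter₂.2 fun i hi =>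
      inner_sub_sub_nonpos_iff.1 (hy ⟨i, Finset.mem_insert_of_mem hi⟩)⟩
  obtain ⟨y, -, hy⟩ := (isCompact_closedBall _ _).inter_iInter_nonempty B
    (fun _ => Metric.isClosed_closedBall) hfinite
  exact ⟨y, fun i => inner_sub_sub_nonpos_iff.2 (Set.mem_iInter.1 hy i)⟩

end InnerProductSpace

variable {d : ℕ}

section Resolvent

variable {A : SetOp d} {c : ℝ}

theorem mem_setResolvent_iff {x y : E d} : y ∈ setResolvent A x ↔ x - y ∈ A y := by
  simp only [setResolvent, Set.mem_ofPred_eq, ← sub_eq_iff_eq_add', exists_eq_right']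

theorem smulOp_smulOp (b c : ℝ) (A : SetOp d) : smulOp b (smulOp c A) = smulOp (b * c) A := by
  ext x u
  simp [smulOp, mul_smul]

theorem smulOp_addOp (c : ℝ) (F : E d → E d) (A : SetOp d) :
    smulOp c (addOp F A) = addOp (c • F) (smulOp c A) := by
  ext x u
  simp [smulOp, addOp]

theorem mem_addOp_iff {F : E d → E d} {x w : E d} : w ∈ addOp F A x ↔ w - F x ∈ A x := by
  simp only [addOp, Set.mem_ofPred_eq, ← sub_eq_iff_eq_add', exists_eq_right']

protected theorem IsMonotoneOp.smulOp (hA : IsMonotoneOp A) (hc : 0 ≤ c) :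
    IsMonotoneOp (smulOp c A) := by
  rintro x y _ _ ⟨u, hu, rfl⟩ ⟨v, hv, rfl⟩
  rw [← smul_sub, real_inner_smul_left]
  exact mul_nonneg hc (hA x y u v hu hv)

protected theorem IsMaximallyMonotone.smulOp (hA : IsMaximallyMonotone A) (hc : 0 < c) :
    IsMaximallyMonotone (smulOp c A) := by
  refine ⟨hA.1.smulOp hc.le, fun A' hA' hsub => ?_⟩
  have hmax : smulOp c⁻¹ A' = A :=
    hA.2 _ (hA'.smulOp (inv_nonneg.2 hc.le)) fun x u hu =>
      ⟨c • u, hsub x ⟨u, hu, rfl⟩, (inv_smul_smul₀ hc.ne' u).symm⟩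
  rw [← hmax, smulOp_smulOp, mul_inv_cancel₀ hc.ne']
  ext x u
  simp [smulOp]

theorem IsMaximallyMonotone.mem_of_forall_inner_nonneg (hA : IsMaximallyMonotone A) {y v : E d}
    (h : ∀ x, ∀ u ∈ A x, 0 ≤ inner ℝ (u - v) (x - y)) : v ∈ A y := by
  have hext := hA.2 (fun x => {u | u ∈ A x ∨ x = y ∧ u = v}) ?_ fun _ _ => Or.inl
  · rw [← hext]
    exact Or.inr ⟨rfl, rfl⟩
  · rintro x x' u u' (hu | ⟨rfl, rfl⟩) (hu' | ⟨rfl, rfl⟩)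
    · exact hA.1 _ _ _ _ hu hu'
    · exact h _ _ hu
    · rw [← neg_sub u', ← neg_sub x', inner_neg_neg]
      exact h _ _ hu'
    · simp

theorem IsMaximallyMonotone.nonempty_setResolvent (hA : IsMaximallyMonotone A) (x : E d) :
    (setResolvent A x).Nonempty := by
  obtain ⟨y, hy⟩ := exists_forall_inner_sub_sub_nonpos
    (a := fun i : {i : E d × E d // i.2 ∈ A i.1} => i.1.1) (b := fun i => x - i.1.2)
    fun i j => by
      have h := hA.1 _ _ _ _ j.2 i.2
      rwa [sub_sub_sub_cancel_left, ← neg_sub, inner_neg_left, neg_nonpos, real_inner_comm]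
  refine ⟨y, mem_setResolvent_iff.2 (hA.mem_of_forall_inner_nonneg fun a u hu => ?_)⟩
  have h := hy ⟨(a, u), hu⟩
  rwa [sub_right_comm, ← neg_sub u, inner_neg_right, neg_nonpos, real_inner_comm] at h

theorem IsMonotoneOp.norm_sub_le_of_mem_setResolvent (hA : IsMonotoneOp A) {x x' y y' : E d}
    (hy : y ∈ setResolvent A x) (hy' : y' ∈ setResolvent A x') : ‖y - y'‖ ≤ ‖x - x'‖ := by
  have hmono := hA _ _ _ _ (mem_setResolvent_iff.1 hy) (mem_setResolvent_iff.1 hy')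
  have hfirm : ‖y - y'‖ * ‖y - y'‖ ≤ ‖x - x'‖ * ‖y - y'‖ := by
    rw [sub_sub_sub_comm, inner_sub_left, real_inner_self_eq_norm_mul_norm, sub_nonneg] at hmono
    exact hmono.trans (real_inner_le_norm _ _)
  rcases (norm_nonneg (y - y')).eq_or_lt with hzero | hpos
  · exact hzero ▸ norm_nonneg _
  · exact le_of_mul_le_mul_right hfirm hpos

theorem resolventMap_mem_setResolvent {x : E d} (h : (setResolvent A x).Nonempty) :
    resolventMap A x ∈ setResolvent A x := by
  rw [resolventMap, dif_pos h]
  exact h.some_mem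

theorem IsMaximallyMonotone.resolventMap_mem (hA : IsMaximallyMonotone A) (x : E d) :
    resolventMap A x ∈ setResolvent A x :=
  resolventMap_mem_setResolvent (hA.nonempty_setResolvent x)

theorem IsMaximallyMonotone.lipschitzWith_resolventMap (hA : IsMaximallyMonotone A) :
    LipschitzWith 1 (resolventMap A) :=
  LipschitzWith.of_dist_le_mul fun x x' => by
    simpa only [NNReal.coe_one, one_mul, dist_eq_norm] using
      hA.1.norm_sub_le_of_mem_setResolvent (hA.resolventMap_mem x) (hA.resolventMap_mem x')

-- A point of `J_{F+A} x` is a fixed point of the contraction `y ↦ J_A (x - F y)`.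
theorem IsMaximallyMonotone.nonempty_setResolvent_addOp (hA : IsMaximallyMonotone A)
    {F : E d → E d} {K : ℝ≥0} (hF : LipschitzWith K F) (hK : K < 1) (x : E d) :
    (setResolvent (addOp F A) x).Nonempty := by
  have hlip := hA.lipschitzWith_resolventMap.comp ((LipschitzWith.const x).sub hF)
  rw [zero_add, one_mul] at hlip
  have hcontr : ContractingWith K fun y => resolventMap A (x - F y) := ⟨hK, hlip⟩
  have hfix : resolventMap A (x - F hcontr.fixedPoint) = hcontr.fixedPoint :=
    hcontr.fixedPoint_isFixedPt
  refine ⟨hcontr.fixedPoint, ?_⟩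
  have hmem := hA.resolventMap_mem (x - F hcontr.fixedPoint)
  rw [hfix, mem_setResolvent_iff, sub_right_comm] at hmem
  rwa [mem_setResolvent_iff, mem_addOp_iff]

theorem IsCohypomonotone.cocoercive_sub_resolvent {ρ η : ℝ} (hA : IsCohypomonotone ρ A)
    (hη : 0 < η) {x x' y y' : E d} (hy : y ∈ setResolvent (smulOp η A) x)
    (hy' : y' ∈ setResolvent (smulOp η A) x') :
    (1 - ρ / η) * ‖(x - y) - (x' - y')‖ ^ 2 ≤ inner ℝ ((x - y) - (x' - y')) (x - x') := by
  rw [mem_setResolvent_iff] at hy hy'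
  obtain ⟨u, hu, hxy⟩ := hy
  obtain ⟨u', hu', hxy'⟩ := hy'
  have hcohypo := mul_le_mul_of_nonneg_left (hA _ _ _ _ hu hu') hη.le
  have hsplit : x - x' = (y - y') + η • (u - u') := by
    rw [smul_sub, ← hxy, ← hxy']
    abel
  rw [hsplit, hxy, hxy', ← smul_sub, inner_add_right, real_inner_self_eq_norm_sq,
    real_inner_smul_left, norm_smul, Real.norm_of_nonneg hη.le]
  have hscale : (1 - ρ / η) * (η * ‖u - u'‖) ^ 2 =
      η * (-ρ * ‖u - u'‖ ^ 2) + (η * ‖u - u'‖) ^ 2 := by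
    field_simp
    ring
  linarith

theorem IsCohypomonotone.subsingleton_setResolvent {ρ η : ℝ} (hA : IsCohypomonotone ρ A)
    (hη : 0 < η) (hρη : ρ < η) (x : E d) : (setResolvent (smulOp η A) x).Subsingleton := by
  intro y hy y' hy'
  have hα : 0 < 1 - ρ / η := sub_pos.2 ((div_lt_one hη).2 hρη)
  have h := hA.cocoercive_sub_resolvent hη hy hy'
  rw [sub_self x, inner_zero_right, sub_sub_sub_cancel_left] at h
  have hzero : ‖y' - y‖ ^ 2 = 0 := le_antisymm (nonpos_of_mul_nonpos_right h hα) (sq_nonneg _)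
  exact (sub_eq_zero.1 (norm_eq_zero.1 (pow_eq_zero_iff two_ne_zero |>.1 hzero))).symm

theorem mem_setResolvent_smulOp_self {x : E d} (hx : 0 ∈ A x) (c : ℝ) :
    x ∈ setResolvent (smulOp c A) x :=
  mem_setResolvent_iff.2 ⟨0, hx, by rw [sub_self, smul_zero]⟩

end Resolvent

section ForwardBackwardForward

section Step

variable {V : Type*} [NormedAddCommGroup V] [InnerProductSpace ℝ V]

theorem norm_fbf_step_sub_sq_le {B : V → V} {z w s : V} {τ μ l : ℝ} (hτ : 0 ≤ τ)
    (hmono : 0 ≤ inner ℝ (w - s) (z - τ • B z - w + τ • B s))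
    (hstrong : μ * ‖w - s‖ ^ 2 ≤ inner ℝ (w - s) (B w - B s))
    (hlip : ‖B z - B w‖ ≤ l * ‖z - w‖) :
    ‖w + τ • B z - τ • B w - s‖ ^ 2 ≤
      ‖z - s‖ ^ 2 - (1 - (τ * l) ^ 2) * ‖z - w‖ ^ 2 - 2 * τ * μ * ‖w - s‖ ^ 2 := by
  have hcorr : ‖τ • (B z - B w)‖ ^ 2 ≤ (τ * l) ^ 2 * ‖z - w‖ ^ 2 := by
    rw [← mul_pow, norm_smul, Real.norm_of_nonneg hτ, mul_assoc]
    gcongr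
  have hnext : w + τ • B z - τ • B w - s = (w - s) + τ • (B z - B w) := by module
  have hprev : z - s = (w - s) + (z - w) := by abel
  have hmonoSplit : z - τ • B z - w + τ • B s = (z - w) - τ • (B z - B w) - τ • (B w - B s) := by
    module
  rw [hmonoSplit, inner_sub_right, inner_sub_right, real_inner_smul_right _ (B w - B s)] at hmono
  rw [hnext, hprev, norm_add_sq_real, norm_add_sq_real]
  linarith [mul_le_mul_of_nonneg_left hstrong hτ]

-- Minimizing `(3 / 4) a ^ 2 + q b ^ 2` over `a + b = c` gives `3 q / (3 + 4 q) * c ^ 2`.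
theorem three_mul_sq_add_le (q a b : ℝ) :
    3 * q * (a + b) ^ 2 ≤ (3 + 4 * q) * (3 / 4 * a ^ 2 + q * b ^ 2) := by
  linarith [sq_nonneg (3 / 2 * a - 2 * q * b)]

theorem three_add_div_le_exp {q : ℝ} (hq : 0 ≤ q) (hq1 : q ≤ 1) :
    (3 + q) / (3 + 4 * q) ≤ Real.exp (-(q / 2)) := by
  have hexp : Real.exp (q / 2) ≤ 1 + q / 2 + (q / 2) ^ 2 := by
    have h := Real.abs_exp_sub_one_sub_id_le (x := q / 2) (by rw [abs_of_nonneg] <;> linarith)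
    linarith [(abs_le.1 h).2]
  rw [Real.exp_neg, ← one_div, div_le_div_iff₀ (by positivity) (Real.exp_pos _), one_mul]
  calc (3 + q) * Real.exp (q / 2) ≤ (3 + q) * (1 + q / 2 + (q / 2) ^ 2) := by gcongr
    _ = 3 + 4 * q - q * (1 - q) * (6 + q) / 4 := by ring
    _ ≤ 3 + 4 * q := sub_le_self _ (by have := sub_nonneg.2 hq1; positivity)

theorem norm_fbf_step_sub_le {B : V → V} {z w s : V} {τ μ l : ℝ} (hl : 0 < l)
    (hτ : τ = 1 / (2 * l)) (hμ : 0 ≤ μ) (hμl : μ ≤ l)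
    (hmono : 0 ≤ inner ℝ (w - s) (z - τ • B z - w + τ • B s))
    (hstrong : μ * ‖w - s‖ ^ 2 ≤ inner ℝ (w - s) (B w - B s))
    (hlip : ‖B z - B w‖ ≤ l * ‖z - w‖) :
    ‖w + τ • B z - τ • B w - s‖ ≤ Real.exp (-(μ / (4 * l))) * ‖z - s‖ := by
  obtain ⟨q, hq⟩ : ∃ q, q = μ / l := ⟨_, rfl⟩
  have hq0 : 0 ≤ q := hq ▸ by positivity
  have hq1 : q ≤ 1 := hq ▸ (div_le_one hl).2 hμl
  have hdescent : ‖w + τ • B z - τ • B w - s‖ ^ 2 ≤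
      ‖z - s‖ ^ 2 - (3 / 4 * ‖z - w‖ ^ 2 + q * ‖w - s‖ ^ 2) := by
    have hτl : τ * l = 1 / 2 := by rw [hτ]; field_simp
    have hτμ : 2 * τ * μ = q := by rw [hτ, hq]; field_simp
    have h := norm_fbf_step_sub_sq_le (hτ ▸ by positivity) hmono hstrong hlip
    rw [hτl, hτμ] at h
    linarith
  have htriangle : 3 * q * ‖z - s‖ ^ 2 ≤
      (3 + 4 * q) * (3 / 4 * ‖z - w‖ ^ 2 + q * ‖w - s‖ ^ 2) := by
    refine le_trans ?_ (three_mul_sq_add_le q _ _)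
    gcongr
    exact norm_sub_le_norm_sub_add_norm_sub _ _ _
  refine le_of_sq_le_sq ?_ (by positivity)
  calc ‖w + τ • B z - τ • B w - s‖ ^ 2 ≤ (3 + q) / (3 + 4 * q) * ‖z - s‖ ^ 2 := by
        rw [div_mul_eq_mul_div, le_div_iff₀ (by positivity)]
        linarith [mul_le_mul_of_nonneg_right hdescent (by positivity : 0 ≤ 3 + 4 * q)]
    _ ≤ Real.exp (-(q / 2)) * ‖z - s‖ ^ 2 := by
        gcongr
        exact three_add_div_le_exp hq0 hq1
    _ = (Real.exp (-(μ / (4 * l))) * ‖z - s‖) ^ 2 := by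
        rw [mul_pow, ← Real.exp_nat_mul, hq]
        congr 2
        push_cast
        ring

theorem one_sub_mul_norm_sq_le_inner {F : V → V} {K : ℝ≥0} (hF : LipschitzWith K F) (x y : V) :
    (1 - K) * ‖x - y‖ ^ 2 ≤ inner ℝ (x - y) ((x + F x) - (y + F y)) := by
  rw [add_sub_add_comm, inner_add_right, real_inner_self_eq_norm_sq]
  have hinner : -(K * ‖x - y‖ ^ 2) ≤ inner ℝ (x - y) (F x - F y) := by
    refine neg_le_of_abs_le ((abs_real_inner_le_norm _ _).trans ?_)
    rw [sq, mul_left_comm]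
    gcongr
    exact hF.norm_sub_le x y
  linarith

end Step

theorem norm_fbf_sub_le {A : SetOp d} {JA : ℝ → E d → Counted (E d)} {Bin : E d → Counted (E d)}
    {LB μ : ℝ} {z₀ s : E d} (hA : IsMonotoneOp A)
    (hJA : ∀ τ > 0, ∀ x, (JA τ x).val ∈ setResolvent (smulOp τ A) x)
    (hLB : 0 < LB) (hμ : 0 ≤ μ) (hμLB : μ ≤ LB)
    (hstrong : ∀ z w, μ * ‖z - w‖ ^ 2 ≤ inner ℝ (z - w) ((Bin z).val - (Bin w).val))
    (hlip : ∀ z w, ‖(Bin z).val - (Bin w).val‖ ≤ LB * ‖z - w‖)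
    (hs : z₀ - (Bin s).val ∈ A s) (t : ℕ) :
    ‖(fbf z₀ JA Bin LB t).val - s‖ ≤ Real.exp (-(μ / (4 * LB))) ^ t * ‖z₀ - s‖ := by
  induction t with
  | zero => rw [pow_zero, one_mul]; rfl
  | succ t ih =>
    let τ := 1 / (2 * LB)
    have hτ : 0 < τ := by positivity
    let B : E d → E d := fun z => (Bin z).val - z₀
    set z := (fbf z₀ JA Bin LB t).val
    set w := (JA τ (z - τ • B z)).val
    have hmono : 0 ≤ inner ℝ (w - s) (z - τ • B z - w + τ • B s) := by
      have h := hA.smulOp hτ.le _ _ _ _ (mem_setResolvent_iff.1 (hJA τ hτ (z - τ • B z)))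
        ⟨_, hs, rfl⟩
      rwa [real_inner_comm, ← neg_sub (Bin s).val, smul_neg, sub_neg_eq_add] at h
    calc ‖w + τ • B z - τ • B w - s‖ ≤ Real.exp (-(μ / (4 * LB))) * ‖z - s‖ := by
          refine norm_fbf_step_sub_le hLB rfl hμ hμLB hmono ?_ ?_
          · simpa only [B, sub_sub_sub_cancel_right] using hstrong w s
          · simpa only [B, sub_sub_sub_cancel_right] using hlip z w
      _ ≤ Real.exp (-(μ / (4 * LB))) * (Real.exp (-(μ / (4 * LB))) ^ t * ‖z₀ - s‖) := by gcongr
      _ = Real.exp (-(μ / (4 * LB))) ^ (t + 1) * ‖z₀ - s‖ := by rw [pow_succ', mul_assoc]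

end ForwardBackwardForward

section ApproxResolvent

/-- The accuracy, relative to `‖x_k - J(x_k)‖`, that the `N_k` inner iterations at outer iteration
`k` reach. -/
noncomputable def innerAccuracy (k : ℕ) : ℝ :=
  1 / (98 * Real.sqrt ((k : ℝ) + 2) * Real.log ((k : ℝ) + 2))

theorem log_add_two_pos (k : ℕ) : 0 < Real.log ((k : ℝ) + 2) :=
  Real.log_pos (by linarith [k.cast_nonneg (α := ℝ)])

theorem innerAccuracy_pos (k : ℕ) : 0 < innerAccuracy k := by
  have := log_add_two_pos k
  unfold innerAccuracy
  positivity

theorem exp_pow_innerIterations_le {η L : ℝ} (hηL₀ : 0 ≤ η * L) (hηL : η * L < 1) (k : ℕ) :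
    Real.exp (-((1 - η * L) / (4 * (1 + η * L)))) ^ innerIterations η L k ≤ innerAccuracy k := by
  have hμ : 0 < 1 - η * L := sub_pos.2 hηL
  have hceil : 4 * (1 + η * L) / (1 - η * L) * -Real.log (innerAccuracy k) ≤
      innerIterations η L k := by
    rw [innerAccuracy, one_div, Real.log_inv, neg_neg]
    exact Nat.le_ceil _
  rw [← Real.exp_nat_mul, ← Real.le_log_iff_exp_le (innerAccuracy_pos k), mul_neg, neg_le,
    mul_div_assoc', le_div_iff₀ (by positivity)]
  rwa [div_mul_eq_mul_div, div_le_iff₀ hμ, mul_comm] at hceil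

theorem norm_approxResolvent_sub_le {F : E d → E d} {G : SetOp d} {L : ℝ≥0} {η : ℝ}
    (hF : LipschitzWith L F) (hG : IsMaximallyMonotone G) (hη : 0 < η) (hηL : η * L < 1)
    {x y : E d} (hy : y ∈ setResolvent (smulOp η (addOp F G)) x) (t : ℕ) :
    ‖(approxResolvent F G η L x t).val - y‖ ≤
      Real.exp (-((1 - η * L) / (4 * (1 + η * L)))) ^ t * ‖x - y‖ := by
  have hηF : LipschitzWith (‖η‖₊ * L) (η • F) := (lipschitzWith_smul η).comp hF
  have hcoe : ((‖η‖₊ * L : ℝ≥0) : ℝ) = η * L := by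
    rw [NNReal.coe_mul, coe_nnnorm, Real.norm_of_nonneg hη.le]
  have hηL₀ : 0 ≤ η * L := by positivity
  refine norm_fbf_sub_le (A := smulOp η G) (hG.1.smulOp hη.le) ?_ (by positivity)
    (sub_nonneg.2 hηL.le) (by linarith) ?_ ?_ ?_ t
  · intro τ hτ z
    rw [smulOp_smulOp]
    exact (hG.smulOp (mul_pos hτ hη)).resolventMap_mem z
  · intro z w
    rw [← hcoe]
    exact one_sub_mul_norm_sq_le_inner hηF z w
  · intro z w
    rw [← hcoe]
    exact (LipschitzWith.id.add hηF).norm_sub_le z w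
  · rw [smulOp_addOp, mem_setResolvent_iff, mem_addOp_iff, sub_sub] at hy
    exact hy

theorem approxResolvent_evals (F : E d → E d) (G : SetOp d) (η L : ℝ) (x : E d) (t : ℕ) :
    (approxResolvent F G η L x t).evals = 2 * t := by
  induction t with
  | zero => rfl
  | succ t ih =>
    change (approxResolvent F G η L x t).evals + (1 + 0 + (0 + (1 + 0 + 0))) = _
    rw [ih, mul_add_one]

theorem approxResolvent_resolvents (F : E d → E d) (G : SetOp d) (η L : ℝ) (x : E d) (t : ℕ) :
    (approxResolvent F G η L x t).resolvents = t := by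
  induction t with
  | zero => rfl
  | succ t ih =>
    change (approxResolvent F G η L x t).resolvents + (0 + 0 + (1 + (0 + 0 + 0))) = _
    rw [ih]

end ApproxResolvent

section LogSum

theorem one_div_mul_log_sq_le {x : ℝ} (hx : 1 < x) :
    1 / ((x + 1) * Real.log (x + 1) ^ 2) ≤ 1 / Real.log x - 1 / Real.log (x + 1) := by
  have hlog : 0 < Real.log x := Real.log_pos hx
  have hle : Real.log x ≤ Real.log (x + 1) := Real.log_le_log (by linarith) (by linarith)
  have hlog' : 0 < Real.log (x + 1) := hlog.trans_le hle
  have hdiff : 1 / (x + 1) ≤ Real.log (x + 1) - Real.log x := by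
    have h := Real.one_sub_inv_le_log_of_pos (x := (x + 1) / x) (by positivity)
    rw [Real.log_div (by positivity) (by positivity), inv_div] at h
    exact h.trans' (le_of_eq (by field_simp; ring))
  calc 1 / ((x + 1) * Real.log (x + 1) ^ 2) = 1 / (x + 1) / Real.log (x + 1) ^ 2 := by
        rw [div_div]
    _ ≤ (Real.log (x + 1) - Real.log x) / (Real.log x * Real.log (x + 1)) := by
        rw [sq]
        gcongr
    _ = 1 / Real.log x - 1 / Real.log (x + 1) := by field_simp

theorem sum_range_one_div_mul_log_sq_le (n : ℕ) :
    ∑ j ∈ Finset.range n, 1 / (((j : ℝ) + 2) * Real.log ((j : ℝ) + 2) ^ 2) ≤ 3 := by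
  have htail : ∑ j ∈ Finset.range n, 1 / (((j : ℝ) + 3) * Real.log ((j : ℝ) + 3) ^ 2) ≤
      1 / Real.log 2 := by
    calc ∑ j ∈ Finset.range n, 1 / (((j : ℝ) + 3) * Real.log ((j : ℝ) + 3) ^ 2)
      _ ≤ ∑ j ∈ Finset.range n, (1 / Real.log ((j : ℝ) + 2) - 1 / Real.log ((j + 1 : ℕ) + 2)) := by
        refine Finset.sum_le_sum fun j _ => ?_
        have h := one_div_mul_log_sq_le (x := (j : ℝ) + 2) (by linarith [j.cast_nonneg (α := ℝ)])
        rw [add_assoc, two_add_one_eq_three] at h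
        rwa [Nat.cast_add_one, add_assoc, add_comm 1 (2 : ℝ), two_add_one_eq_three]
      _ = 1 / Real.log 2 - 1 / Real.log ((n : ℝ) + 2) := by
        rw [Finset.sum_range_sub' fun j : ℕ => 1 / Real.log ((j : ℝ) + 2), Nat.cast_zero, zero_add]
      _ ≤ 1 / Real.log 2 := sub_le_self _ (one_div_pos.2 (log_add_two_pos n)).le
  have hhead : 1 / Real.log 2 + 1 / (2 * Real.log 2 ^ 2) ≤ 3 := by
    have h := Real.log_two_gt_d9
    rw [div_add_div _ _ (by positivity) (by positivity), div_le_iff₀ (by positivity)]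
    nlinarith
  calc ∑ j ∈ Finset.range n, 1 / (((j : ℝ) + 2) * Real.log ((j : ℝ) + 2) ^ 2)
    _ ≤ ∑ j ∈ Finset.range (n + 1), 1 / (((j : ℝ) + 2) * Real.log ((j : ℝ) + 2) ^ 2) :=
      Finset.sum_le_sum_of_subset_of_nonneg (Finset.range_subset_range.2 n.le_succ)
        fun j _ _ => by positivity
    _ = ∑ j ∈ Finset.range n, 1 / (((j : ℝ) + 3) * Real.log ((j : ℝ) + 3) ^ 2) +
        1 / (2 * Real.log 2 ^ 2) := by
      rw [Finset.sum_range_succ', Nat.cast_zero, zero_add]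
      simp only [Nat.cast_add_one, add_assoc]
      norm_num
    _ ≤ 3 := by linarith

end LogSum

section Halpern

variable {V : Type*} [NormedAddCommGroup V] [InnerProductSpace ℝ V]

theorem half_norm_sq_add_inner_le {p p' c e : V}
    (h : ‖p' - p‖ ^ 2 ≤ inner ℝ (p' - p) (e - p - c)) :
    ‖p'‖ ^ 2 / 2 + inner ℝ p' c ≤ ‖p‖ ^ 2 / 2 + inner ℝ p c + ‖e‖ ^ 2 / 2 := by
  obtain ⟨u, rfl⟩ : ∃ u, p' = p + u := ⟨p' - p, by abel⟩
  have hyoung : 2 * inner ℝ u e ≤ ‖u‖ ^ 2 + ‖e‖ ^ 2 := by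
    linarith [sq_nonneg ‖u - e‖, norm_sub_sq_real u e]
  rw [add_sub_cancel_left, inner_sub_right, inner_sub_right, real_inner_comm p] at h
  rw [norm_add_sq_real, inner_add_left]
  linarith

/-- The Lyapunov function of the Halpern iteration `x` of a firmly nonexpansive map with
displacements `p k`; it does not increase when the map is evaluated exactly. -/
noncomputable def halpernPotential (x p : ℕ → V) (k : ℕ) : ℝ :=
  (k : ℝ) * ((k : ℝ) + 1) / 2 * ‖p k‖ ^ 2 + ((k : ℝ) + 1) * inner ℝ (p k) (x k - x 0)

theorem halpernPotential_succ_le {x p : ℕ → V} {e : V} {k : ℕ}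
    (hstep : x (k + 1) =
      (1 / ((k : ℝ) + 2)) • x 0 + (1 - 1 / ((k : ℝ) + 2)) • (x k - p k + e))
    (hcoc : ‖p (k + 1) - p k‖ ^ 2 ≤ inner ℝ (p (k + 1) - p k) (x (k + 1) - x k)) :
    halpernPotential x p (k + 1) ≤ halpernPotential x p k +
      (((k : ℝ) + 1) * ((k : ℝ) + 2) / 2 * ‖e‖ ^ 2 + ((k : ℝ) + 1) * (‖p k‖ * ‖e‖)) := by
  obtain ⟨c, hc⟩ : ∃ c : V, c = (1 / ((k : ℝ) + 2)) • (x k - x 0 - p k + e) := ⟨_, rfl⟩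
  have hold : x k - x 0 = ((k : ℝ) + 2) • c + p k - e := by
    rw [hc, smul_smul, mul_one_div_cancel (by positivity)]
    module
  have hnew : x (k + 1) - x 0 = ((k : ℝ) + 1) • c := by
    rw [hstep, hc, smul_smul, mul_one_div, show ((k : ℝ) + 1) / ((k : ℝ) + 2) =
      1 - 1 / ((k : ℝ) + 2) by field_simp; ring]
    module
  have hmove : x (k + 1) - x k = e - p k - c := by
    rw [← sub_sub_sub_cancel_right _ _ (x 0), hnew, hold]
    module
  rw [hmove] at hcoc
  have hdescent := mul_le_mul_of_nonneg_left (half_norm_sq_add_inner_le hcoc)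
    (by positivity : 0 ≤ ((k : ℝ) + 1) * ((k : ℝ) + 2))
  have herror := mul_le_mul_of_nonneg_left (real_inner_le_norm (p k) e)
    (by positivity : 0 ≤ (k : ℝ) + 1)
  simp only [halpernPotential, hold, hnew, inner_sub_right, inner_add_right,
    real_inner_smul_right, real_inner_self_eq_norm_sq, Nat.cast_add_one]
  linarith

theorem norm_le_of_halpernPotential_le {x p : ℕ → V} {s : V} {k : ℕ}
    (hsol : ‖p k‖ ^ 2 ≤ inner ℝ (p k) (x k - s))
    (hW : halpernPotential x p k ≤ ‖x 0 - s‖ ^ 2) :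
    ‖p k‖ ≤ 4 * ‖x 0 - s‖ / ((k : ℝ) + 2) := by
  have hinner : ‖p k‖ ^ 2 - ‖p k‖ * ‖x 0 - s‖ ≤ inner ℝ (p k) (x k - x 0) := by
    rw [← sub_sub_sub_cancel_right (x k) (x 0) s, inner_sub_right]
    linarith [real_inner_le_norm (p k) (x 0 - s)]
  unfold halpernPotential at hW
  set a := ‖p k‖
  set D := ‖x 0 - s‖
  have hquad : ((k : ℝ) + 1) * ((((k : ℝ) + 2) * a) ^ 2 - 2 * (((k : ℝ) + 2) * a) * D) ≤
      ((k : ℝ) + 1) * (4 * D ^ 2) := by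
    calc ((k : ℝ) + 1) * ((((k : ℝ) + 2) * a) ^ 2 - 2 * (((k : ℝ) + 2) * a) * D)
      _ = 2 * ((k : ℝ) + 2) *
          (k * ((k : ℝ) + 1) / 2 * a ^ 2 + ((k : ℝ) + 1) * (a ^ 2 - a * D)) := by ring
      _ ≤ 2 * ((k : ℝ) + 2) * D ^ 2 := by
        gcongr
        exact hW.trans' (by gcongr)
      _ ≤ ((k : ℝ) + 1) * (4 * D ^ 2) := by
        linarith [mul_nonneg k.cast_nonneg (sq_nonneg D)]
  have hsq : (((k : ℝ) + 2) * a - D) ^ 2 ≤ (3 * D) ^ 2 := by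
    linarith [le_of_mul_le_mul_left hquad (by positivity), sq_nonneg D]
  rw [le_div_iff₀' (by positivity)]
  linarith [(abs_le_of_sq_le_sq' hsq (by positivity)).2]

theorem innerAccuracy_sq (k : ℕ) :
    innerAccuracy k ^ 2 = 1 / 9604 * (1 / (((k : ℝ) + 2) * Real.log ((k : ℝ) + 2) ^ 2)) := by
  rw [innerAccuracy, div_pow, mul_pow, mul_pow, Real.sq_sqrt (by positivity)]
  field_simp
  norm_num

theorem innerAccuracy_div_le (k : ℕ) :
    innerAccuracy k / ((k : ℝ) + 2) ≤
      1 / 49 * (1 / (((k : ℝ) + 2) * Real.log ((k : ℝ) + 2) ^ 2)) := by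
  have hl := log_add_two_pos k
  have hlog : Real.log ((k : ℝ) + 2) / 2 ≤ Real.sqrt ((k : ℝ) + 2) := by
    rw [← Real.log_sqrt (by positivity)]
    exact Real.log_le_self (Real.sqrt_nonneg _)
  calc innerAccuracy k / ((k : ℝ) + 2)
    _ = 1 / 98 * (1 / (((k : ℝ) + 2) *
        (Real.log ((k : ℝ) + 2) * Real.sqrt ((k : ℝ) + 2)))) := by
      unfold innerAccuracy
      field_simp
    _ ≤ 1 / 98 * (1 / (((k : ℝ) + 2) *
        (Real.log ((k : ℝ) + 2) * (Real.log ((k : ℝ) + 2) / 2)))) := by gcongr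
    _ = 1 / 49 * (1 / (((k : ℝ) + 2) * Real.log ((k : ℝ) + 2) ^ 2)) := by
      field_simp
      norm_num

theorem halpernPotential_increment_le {a ε D : ℝ} (k : ℕ) (ha : 0 ≤ a) (hε : 0 ≤ ε)
    (haD : a ≤ 4 * D / ((k : ℝ) + 2)) (hεa : ε ≤ innerAccuracy k * a) :
    ((k : ℝ) + 1) * ((k : ℝ) + 2) / 2 * ε ^ 2 + ((k : ℝ) + 1) * (a * ε) ≤
      D ^ 2 / 3 * (1 / (((k : ℝ) + 2) * Real.log ((k : ℝ) + 2) ^ 2)) := by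
  have hδ := innerAccuracy_pos k
  have hδsq := innerAccuracy_sq k
  have hδdiv := innerAccuracy_div_le k
  have hkm : (k : ℝ) + 1 ≤ (k : ℝ) + 2 := by linarith
  set m : ℝ := (k : ℝ) + 2
  have hm : 0 < m := by positivity
  set δ := innerAccuracy k
  set r := 1 / (m * Real.log m ^ 2)
  have hma : (m * a) ^ 2 ≤ 16 * D ^ 2 := by
    calc (m * a) ^ 2 ≤ (4 * D) ^ 2 := pow_le_pow_left₀ (by positivity) ((le_div_iff₀' hm).1 haD) 2
      _ = 16 * D ^ 2 := by ring
  calc ((k : ℝ) + 1) * m / 2 * ε ^ 2 + ((k : ℝ) + 1) * (a * ε)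
    _ ≤ m * m / 2 * (δ * a) ^ 2 + m * (a * (δ * a)) := by gcongr
    _ = (m * a) ^ 2 * (δ ^ 2 / 2 + δ / m) := by field_simp
    _ ≤ 16 * D ^ 2 * (1 / 9604 * r / 2 + 1 / 49 * r) := by
      rw [← hδsq]
      gcongr
    _ ≤ D ^ 2 / 3 * r := by
      have : 0 ≤ D ^ 2 * r := by positivity
      linarith

theorem halpern_norm_displacement_le {x p e : ℕ → V} {s : V}
    (hstep : ∀ k : ℕ, x (k + 1) =
      (1 / ((k : ℝ) + 2)) • x 0 + (1 - 1 / ((k : ℝ) + 2)) • (x k - p k + e k))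
    (hcoc : ∀ k, ‖p (k + 1) - p k‖ ^ 2 ≤ inner ℝ (p (k + 1) - p k) (x (k + 1) - x k))
    (hsol : ∀ k, ‖p k‖ ^ 2 ≤ inner ℝ (p k) (x k - s))
    (herr : ∀ k, ‖e k‖ ≤ innerAccuracy k * ‖p k‖) (k : ℕ) :
    ‖p k‖ ≤ 4 * ‖x 0 - s‖ / ((k : ℝ) + 2) := by
  let bound : ℕ → ℝ := fun k => ‖x 0 - s‖ ^ 2 / 3 *
    ∑ j ∈ Finset.range k, 1 / (((j : ℝ) + 2) * Real.log ((j : ℝ) + 2) ^ 2)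
  have hbound (k : ℕ) : bound k ≤ ‖x 0 - s‖ ^ 2 := by
    calc bound k ≤ ‖x 0 - s‖ ^ 2 / 3 * 3 := by
          dsimp only [bound]
          gcongr
          exact sum_range_one_div_mul_log_sq_le k
      _ = ‖x 0 - s‖ ^ 2 := div_mul_cancel₀ _ three_ne_zero
  suffices hW : ∀ k, halpernPotential x p k ≤ bound k from
    norm_le_of_halpernPotential_le (hsol k) ((hW k).trans (hbound k))
  intro k
  induction k with
  | zero => simp [halpernPotential, bound]
  | succ k ih =>
    have hnorm := norm_le_of_halpernPotential_le (hsol k) (ih.trans (hbound k))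
    calc halpernPotential x p (k + 1)
      _ ≤ halpernPotential x p k + (((k : ℝ) + 1) * ((k : ℝ) + 2) / 2 * ‖e k‖ ^ 2 +
          ((k : ℝ) + 1) * (‖p k‖ * ‖e k‖)) := halpernPotential_succ_le (hstep k) (hcoc k)
      _ ≤ bound k + ‖x 0 - s‖ ^ 2 / 3 *
          (1 / (((k : ℝ) + 2) * Real.log ((k : ℝ) + 2) ^ 2)) :=
        add_le_add ih
          (halpernPotential_increment_le k (norm_nonneg _) (norm_nonneg _) hnorm (herr k))
      _ = bound (k + 1) := by rw [← mul_add, ← Finset.sum_range_succ]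

theorem norm_smul_sq_le_inner_smul {α : ℝ} (hα : 0 ≤ α) {v w : V}
    (h : α * ‖v‖ ^ 2 ≤ inner ℝ v w) : ‖α • v‖ ^ 2 ≤ inner ℝ (α • v) w := by
  rw [norm_smul, Real.norm_of_nonneg hα, real_inner_smul_left, mul_pow, sq α, mul_assoc]
  exact mul_le_mul_of_nonneg_left h hα

end Halpern

section HalpernResolvent

theorem halpern_val_succ (F : E d → E d) (G : SetOp d) (η L ρ : ℝ) (x₀ : E d) (k : ℕ) :
    (halpern F G η L ρ x₀ (k + 1)).val =
      let x := (halpern F G η L ρ x₀ k).val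
      (1 / ((k : ℝ) + 2)) • x₀ + (1 - 1 / ((k : ℝ) + 2)) •
        ((1 - (1 - ρ / η)) • x + (1 - ρ / η) •
          (approxResolvent F G η L x (innerIterations η L k)).val) := rfl

variable {F : E d → E d} {G : SetOp d} {L : ℝ≥0} {ρ η : ℝ}

theorem IsMaximallyMonotone.nonempty_setResolvent_smulOp_addOp (hG : IsMaximallyMonotone G)
    (hF : LipschitzWith L F) (hη : 0 < η) (hηL : η * L < 1) (x : E d) :
    (setResolvent (smulOp η (addOp F G)) x).Nonempty := by
  rw [smulOp_addOp]
  refine (hG.smulOp hη).nonempty_setResolvent_addOp ((lipschitzWith_smul η).comp hF) ?_ x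
  rwa [← NNReal.coe_lt_coe, NNReal.coe_mul, coe_nnnorm, Real.norm_of_nonneg hη.le]

theorem exists_setResolvent_halpern_eq_singleton (hF : LipschitzWith L F)
    (hG : IsMaximallyMonotone G) (hη : 0 < η) (hA : IsCohypomonotone ρ (addOp F G))
    (hρη : ρ < η) (hηL : η * L < 1) (x₀ : E d) {s : E d} (hs : 0 ∈ addOp F G s) (k : ℕ) :
    ∃ y, setResolvent (smulOp η (addOp F G)) (halpern F G η L ρ x₀ k).val = {y} ∧
      (1 - ρ / η) * ‖(halpern F G η L ρ x₀ k).val - y‖ ≤ 4 * ‖x₀ - s‖ / ((k : ℝ) + 2) := by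
  set α := 1 - ρ / η
  have hα : 0 ≤ α := sub_nonneg.2 ((div_le_one hη).2 hρη.le)
  let x : ℕ → E d := fun k => (halpern F G η L ρ x₀ k).val
  choose y hy using fun k => hG.nonempty_setResolvent_smulOp_addOp hF hη hηL (x k)
  let p : ℕ → E d := fun k => α • (x k - y k)
  let e : ℕ → E d := fun k =>
    α • ((approxResolvent F G η L (x k) (innerIterations η L k)).val - y k)
  have hstep (k : ℕ) : x (k + 1) =
      (1 / ((k : ℝ) + 2)) • x 0 + (1 - 1 / ((k : ℝ) + 2)) • (x k - p k + e k) := by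
    have hrelax : x k - p k + e k = (1 - α) • x k +
        α • (approxResolvent F G η L (x k) (innerIterations η L k)).val := by
      dsimp only [p, e]
      module
    rw [hrelax]
    exact halpern_val_succ F G η L ρ x₀ k
  have hcoc (k : ℕ) : ‖p (k + 1) - p k‖ ^ 2 ≤ inner ℝ (p (k + 1) - p k) (x (k + 1) - x k) := by
    rw [← smul_sub]
    exact norm_smul_sq_le_inner_smul hα
      (hA.cocoercive_sub_resolvent hη (hy (k + 1)) (hy k))
  have hsol (k : ℕ) : ‖p k‖ ^ 2 ≤ inner ℝ (p k) (x k - s) := by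
    have h := hA.cocoercive_sub_resolvent hη (hy k) (mem_setResolvent_smulOp_self hs η)
    rw [sub_self, sub_zero] at h
    exact norm_smul_sq_le_inner_smul hα h
  have herr (k : ℕ) : ‖e k‖ ≤ innerAccuracy k * ‖p k‖ := by
    rw [norm_smul, norm_smul, mul_left_comm]
    gcongr
    exact (norm_approxResolvent_sub_le hF hG hη hηL (hy k) _).trans
      (by gcongr; exact exp_pow_innerIterations_le (by positivity) hηL k)
  refine ⟨y k, (hA.subsingleton_setResolvent hη hρη (x k)).eq_singleton_of_mem (hy k), ?_⟩
  have h := halpern_norm_displacement_le hstep hcoc hsol herr k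
  rwa [norm_smul, Real.norm_of_nonneg hα] at h

end HalpernResolvent

section OracleCalls

theorem halpern_evals (F : E d → E d) (G : SetOp d) (η L ρ : ℝ) (x₀ : E d) (k : ℕ) :
    (halpern F G η L ρ x₀ k).evals = ∑ j ∈ Finset.range k, 2 * innerIterations η L j := by
  induction k with
  | zero => rfl
  | succ k ih =>
    rw [Finset.sum_range_succ, ← ih, ← approxResolvent_evals F G η L (halpern F G η L ρ x₀ k).val]
    rfl

theorem halpern_resolvents (F : E d → E d) (G : SetOp d) (η L ρ : ℝ) (x₀ : E d) (k : ℕ) :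
    (halpern F G η L ρ x₀ k).resolvents = ∑ j ∈ Finset.range k, innerIterations η L j := by
  induction k with
  | zero => rfl
  | succ k ih =>
    rw [Finset.sum_range_succ, ← ih]
    conv_rhs => rw [← approxResolvent_resolvents F G η L (halpern F G η L ρ x₀ k).val
      (innerIterations η L k)]
    rfl

theorem halpern_oracleCalls (F : E d → E d) (G : SetOp d) (η L ρ : ℝ) (x₀ : E d) (k : ℕ) :
    (halpern F G η L ρ x₀ k).oracleCalls = ∑ j ∈ Finset.range k, 2 * innerIterations η L j := by
  rw [Counted.oracleCalls, halpern_evals, halpern_resolvents]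
  exact max_eq_left (Finset.sum_le_sum fun j _ => Nat.le_mul_of_pos_left _ two_pos)

theorem innerIterations_le {η L : ℝ} (hηL₀ : 0 ≤ η * L) (hηL : η * L < 1) (k : ℕ) :
    (innerIterations η L k : ℝ) ≤
      (1 + η * L) / (1 - η * L) * (4 * Real.log 98 + 6 * Real.log ((k : ℝ) + 2) + 1) := by
  have hl := log_add_two_pos k
  have hμ : 0 < 1 - η * L := sub_pos.2 hηL
  have hκ : 1 ≤ (1 + η * L) / (1 - η * L) := by
    rw [le_div_iff₀ hμ]
    linarith
  have hlog : Real.log (98 * Real.sqrt ((k : ℝ) + 2) * Real.log ((k : ℝ) + 2)) ≤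
      Real.log 98 + 3 / 2 * Real.log ((k : ℝ) + 2) := by
    rw [Real.log_mul (by positivity) hl.ne', Real.log_mul (by norm_num) (by positivity),
      Real.log_sqrt (by positivity)]
    linarith [Real.log_le_self hl.le]
  calc (innerIterations η L k : ℝ)
    _ ≤ ⌈4 * (1 + η * L) / (1 - η * L) *
        (Real.log 98 + 3 / 2 * Real.log ((k : ℝ) + 2))⌉₊ := by
      unfold innerIterations
      gcongr
    _ ≤ 4 * (1 + η * L) / (1 - η * L) *
        (Real.log 98 + 3 / 2 * Real.log ((k : ℝ) + 2)) + 1 :=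
      (Nat.ceil_lt_add_one (by positivity)).le
    _ ≤ 4 * (1 + η * L) / (1 - η * L) * (Real.log 98 + 3 / 2 * Real.log ((k : ℝ) + 2)) +
        (1 + η * L) / (1 - η * L) := by gcongr
    _ = (1 + η * L) / (1 - η * L) *
        (4 * Real.log 98 + 6 * Real.log ((k : ℝ) + 2) + 1) := by ring

theorem log_add_two_le_three_mul_log {t X : ℝ} (ht : 0 ≤ t) (htX : t ≤ 4 * X) :
    Real.log (t + 2) ≤ 3 * Real.log (2 + X) := by
  have hlog2 : Real.log 2 ≤ Real.log (2 + X) := Real.log_le_log two_pos (by linarith)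
  calc Real.log (t + 2) ≤ Real.log (2 ^ 2 * (2 + X)) :=
        Real.log_le_log (by positivity) (by linarith)
    _ = 2 * Real.log 2 + Real.log (2 + X) := by
        rw [Real.log_mul (by norm_num) (by linarith), Real.log_pow, Nat.cast_ofNat]
    _ ≤ 3 * Real.log (2 + X) := by linarith

theorem innerIterations_le_mul_log {η L X : ℝ} (hηL₀ : 0 ≤ η * L) (hηL : η * L < 1) {j : ℕ}
    (hj : (j : ℝ) ≤ 4 * X) :
    (innerIterations η L j : ℝ) ≤ (1 + η * L) / (1 - η * L) * (48 * Real.log (2 + X)) := by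
  have hlog2 : Real.log 2 ≤ Real.log (2 + X) :=
    Real.log_le_log two_pos (by linarith [j.cast_nonneg (α := ℝ)])
  have hlog98 : Real.log 98 ≤ 7 * Real.log 2 := by
    rw [← Nat.cast_ofNat (n := 7), ← Real.log_pow]
    exact Real.log_le_log (by norm_num) (by norm_num)
  refine (innerIterations_le hηL₀ hηL j).trans (mul_le_mul_of_nonneg_left ?_
    (div_nonneg (by positivity) (sub_nonneg.2 hηL.le)))
  linarith [Real.log_two_gt_d9, log_add_two_le_three_mul_log j.cast_nonneg hj]

theorem halpern_oracleCalls_le (F : E d → E d) (G : SetOp d) {η L : ℝ} (ρ : ℝ) (x₀ : E d)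
    (hηL₀ : 0 ≤ η * L) (hηL : η * L < 1) {X : ℝ} (hX : 0 ≤ X) :
    ((halpern F G η L ρ x₀ ⌈4 * X⌉₊).oracleCalls : ℝ) ≤
      480 * ((1 + η * L) / (1 - η * L)) * max 1 X * Real.log (2 + X) := by
  set K := ⌈4 * X⌉₊
  set κ := (1 + η * L) / (1 - η * L)
  have : 0 ≤ κ := div_nonneg (by positivity) (sub_nonneg.2 hηL.le)
  have hterm (j : ℕ) (hj : j ∈ Finset.range K) :
      ((2 * innerIterations η L j : ℕ) : ℝ) ≤ 2 * (κ * (48 * Real.log (2 + X))) := by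
    rw [Nat.cast_mul, Nat.cast_ofNat]
    gcongr
    exact innerIterations_le_mul_log hηL₀ hηL (Nat.lt_ceil.1 (Finset.mem_range.1 hj)).le
  have hK : (K : ℝ) ≤ 5 * max 1 X := by
    linarith [Nat.ceil_lt_add_one (by positivity : 0 ≤ 4 * X), le_max_left 1 X, le_max_right 1 X]
  have hlog : 0 ≤ Real.log (2 + X) := Real.log_nonneg (by linarith)
  calc ((halpern F G η L ρ x₀ K).oracleCalls : ℝ)
    _ = ∑ j ∈ Finset.range K, ((2 * innerIterations η L j : ℕ) : ℝ) := by
      rw [halpern_oracleCalls, Nat.cast_sum]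
    _ ≤ K * (2 * (κ * (48 * Real.log (2 + X)))) := by
      simpa only [Finset.card_range, nsmul_eq_mul] using Finset.sum_le_card_nsmul _ _ _ hterm
    _ ≤ 5 * max 1 X * (2 * (κ * (48 * Real.log (2 + X)))) := by gcongr
    _ = 480 * κ * max 1 X * Real.log (2 + X) := by ring

end OracleCalls

theorem corollary1_general {F : E d → E d} {G : SetOp d} {L : ℝ≥0} {ρ η : ℝ}
    (hF : LipschitzWith L F) (hG : IsMaximallyMonotone G) (hη : 0 < η)
    (hA : IsCohypomonotone ρ (addOp F G)) (hρη : ρ < η) (hηL : η * L < 1)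
    (x₀ : E d) {xstar : E d} (hs : 0 ∈ addOp F G xstar) {ε : ℝ} (hε : 0 < ε)
    {K : ℕ} (hK : K = ⌈4 * ‖x₀ - xstar‖ / ((η - ρ) * ε)⌉₊) :
    (∃ y : E d,
      setResolvent (smulOp η (addOp F G)) (halpern F G η L ρ x₀ K).val = {y} ∧
      η⁻¹ * ‖(halpern F G η L ρ x₀ K).val - y‖ ≤ ε) ∧
    ((halpern F G η L ρ x₀ K).oracleCalls : ℝ) ≤
      480 * ((1 + η * L) / (1 - η * L)) * max 1 (‖x₀ - xstar‖ / (ε * (η - ρ))) *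
        Real.log (2 + ‖x₀ - xstar‖ / (ε * (η - ρ))) := by
  have hηρ : 0 < η - ρ := sub_pos.2 hρη
  constructor
  · obtain ⟨y, hy, hle⟩ := exists_setResolvent_halpern_eq_singleton hF hG hη hA hρη hηL x₀ hs K
    refine ⟨y, hy, ?_⟩
    have hKle : 4 * ‖x₀ - xstar‖ ≤ (η - ρ) * ε * ((K : ℝ) + 2) := by
      rw [← div_le_iff₀' (by positivity)]
      linarith [hK ▸ Nat.le_ceil (4 * ‖x₀ - xstar‖ / ((η - ρ) * ε))]
    refine le_of_mul_le_mul_left ?_ hηρ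
    calc (η - ρ) * (η⁻¹ * ‖(halpern F G η L ρ x₀ K).val - y‖)
      _ = (1 - ρ / η) * ‖(halpern F G η L ρ x₀ K).val - y‖ := by field_simp
      _ ≤ 4 * ‖x₀ - xstar‖ / ((K : ℝ) + 2) := hle
      _ ≤ (η - ρ) * ε := div_le_of_le_mul₀ (by positivity) (by positivity) hKle
  · rw [hK, mul_comm ε, mul_div_assoc]
    exact halpern_oracleCalls_le F G ρ x₀ (by positivity) hηL (by positivity)

end InexactHalpern

/-- The soft-O bound is stated with an absolute constant `C` and an absolute exponent `p` of the
logarithm, chosen before the problem and all its parameters. -/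
theorem corollary1 :
    ∃ (C : ℝ) (p : ℕ), 0 < C ∧
      ∀ (d : ℕ) (F : E d → E d) (G : SetOp d) (L : ℝ≥0) (ρ η : ℝ),
        LipschitzWith L F →
        IsMaximallyMonotone G →
        0 < ρ →
        IsMaximallyCohypomonotone ρ (addOp F G) →
        ρ < η →
        η * L < 1 →
        ∀ (x₀ xstar : E d), 0 ∈ addOp F G xstar →
        ∀ ε : ℝ, 0 < ε →
        ∀ K : ℕ, K = ⌈4 * ‖x₀ - xstar‖ / ((η - ρ) * ε)⌉₊ →
          (∃ y : E d,
            setResolvent (smulOp η (addOp F G)) (halpern F G η L ρ x₀ K).val = {y} ∧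
            η⁻¹ * ‖(halpern F G η L ρ x₀ K).val - y‖ ≤ ε) ∧
          ((halpern F G η L ρ x₀ K).oracleCalls : ℝ) ≤
            C * ((1 + η * L) / (1 - η * L)) * max 1 (‖x₀ - xstar‖ / (ε * (η - ρ))) *
              Real.log (2 + ‖x₀ - xstar‖ / (ε * (η - ρ))) ^ p :=
  ⟨480, 1, by norm_num, fun _ _ _ _ _ _ hF hG hρ hA hρη hηL x₀ _ hs _ hε _ hK => by
    simpa only [pow_one] using
      corollary1_general hF hG (hρ.trans hρη) hA.1 hρη hηL x₀ hs hε hK⟩
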